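/- Let $n\ge 3$, $\mathbb{R}^n_+=\{x=(x',x_n)\in\mathbb{R}^n: x_n>0\}$, and identify $\partial\mathbb{R}^n_+$ with $\mathbb{R}^{n-1}$ (with Lebesgue measure $dx'$). For $x,y\in\mathbb{R}^n$ and $t>0$ let $$G(x,y,t)=(4\pi t)^{-n/2}\Big[e^{-|x-y|^2/(4t)}+e^{-|x-y^*|^2/(4t)}\Big],\qquad y^*=(y',-y_n),$$ and for $\psi:\partial\mathbb{R}^n_+\to\mathbb{R}$ let $$\mathcal{G}_1(\psi)(x,t)=\int_{\partial\mathbb{R}^n_+}G(x,(y',0),t)\,\psi(y')\,dy'.$$ For a measurable function $f$ on $\Omega$ (either $\mathbb{R}^n_+$ or $\partial\mathbb{R}^n_+$, with Lebesgue measure $|\cdot|$) put, for $t>0$, $f^*(t)=\inf\{s>0:|\{|f|>s\}|\le t\}$ and $f^{**}(t)=\frac1t\int_0^t f^*(s)\,ds$. For $1<p<\infty$ and $1\le r\le\infty$, the Lorentz space $L^{(p,r)}(\Omega)$ consists of the measurable $f$ with $\big[\int_0^\infty (t^{1/p}f^*(t))^r\frac{dt}{t}\big]^{1/r}<\infty$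 (for $r=\infty$: $\sup_{t>0}t^{1/p}f^*(t)<\infty$), and $\|f\|_{L^{(p,r)}(\Omega)}$ denotes the same quantity with $f^{**}$ in place of $f^*$. Let $1<d_1<d_2<\infty$ and $1\le r\le\infty$. Then there is a constant $C>0$ (depending only on $n,d_1,d_2,r$) such that for all $\psi\in L^{(d_1,r)}(\partial\mathbb{R}^n_+)$ and all $t>0$ the integral defining $\mathcal{G}_1(\psi)(x,t)$ converges absolutely for every $x\in\mathbb{R}^n$, one has $\mathcal{G}_1(\psi)(\cdot,0,t)\in L^{(d_2,r)}(\partial\mathbb{R}^n_+)$ and $\mathcal{G}_1(\psi)(\cdot,t)\in L^{(d_2,r)}(\mathbb{R}^n_+)$, and $$\|\mathcal{G}_1(\psi)(\cdot,0,t)\|_{L^{(d_2,r)}(\partial\mathbb{R}^n_+)}\le C\,t^{-\left(\frac{n-1}{2d_1}-\frac{n-1}{2d_2}+\frac12\right)}\|\psi\|_{L^{(d_1,r)}(\partial\mathbb{R}^n_+)},$$ $$\|\mathcal{G}_1(\psi)(\cdot,t)\|_{L^{(d_2,r)}(\mathbb{R}^n_+)}\le C\,t^{-\left(\frac{n-1}{2d_1}-\frac{n}{2d_2}+\frac12\right)}\|\psi\|_{L^{(d_1,r)}(\partial\mathbb{R}^n_+)}.$$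 -/

import Mathlib

open MeasureTheory Set
open scoped ENNReal

noncomputable section

/-! ## Lorentz spaces -/

section LorentzSpaces

variable {α : Type*} [MeasurableSpace α]

/-- The distribution function `λ_f(s) = μ {x : |f x| > s}`. -/
def distributionFunction (f : α → ℝ) (μ : Measure α) (s : ℝ≥0∞) : ℝ≥0∞ :=
  μ {x | s < ‖f x‖ₑ}

/-- The decreasing rearrangement `f^*(t) = inf {s > 0 : λ_f(s) ≤ t}` (with `inf ∅ = ∞`). -/
def decreasingRearrangement (f : α → ℝ) (μ : Measure α) (t : ℝ) : ℝ≥0∞ :=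
  sInf {s : ℝ≥0∞ | 0 < s ∧ distributionFunction f μ s ≤ ENNReal.ofReal t}

/-- The averaged rearrangement `f^{**}(t) = (1/t) ∫_0^t f^*(s) ds`. -/
def averagedRearrangement (f : α → ℝ) (μ : Measure α) (t : ℝ) : ℝ≥0∞ :=
  (∫⁻ s in Ioo 0 t, decreasingRearrangement f μ s) / ENNReal.ofReal t

/-- `[∫_0^∞ (t^{1/p} φ(t))^r dt/t]^{1/r}` for `r < ∞`, and `sup_{t > 0} t^{1/p} φ(t)` for
`r = ∞`. -/
def lorentzFunctional (p : ℝ) (r : ℝ≥0∞) (φ : ℝ → ℝ≥0∞) : ℝ≥0∞ :=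
  if r = ∞ then ⨆ t ∈ Ioi (0 : ℝ), ENNReal.ofReal t ^ (1 / p) * φ t
  else (∫⁻ t in Ioi (0 : ℝ),
    (ENNReal.ofReal t ^ (1 / p) * φ t) ^ r.toReal / ENNReal.ofReal t) ^ (1 / r.toReal)

/-- The quasi-norm `‖f‖^*_{L^{(p,r)}}`, built on `f^*`. -/
def lorentzQuasiNorm (f : α → ℝ) (p : ℝ) (r : ℝ≥0∞) (μ : Measure α) : ℝ≥0∞ :=
  lorentzFunctional p r (decreasingRearrangement f μ)

/-- The norm `‖f‖_{L^{(p,r)}}`, built on `f^{**}`. -/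
def lorentzNorm (f : α → ℝ) (p : ℝ) (r : ℝ≥0∞) (μ : Measure α) : ℝ≥0∞ :=
  lorentzFunctional p r (averagedRearrangement f μ)

/-- `f ∈ L^{(p,r)}(μ)`. For Lebesgue measure, `AEStronglyMeasurable` is measurability with respect
to the Lebesgue σ-algebra. -/
def MemLorentz (f : α → ℝ) (p : ℝ) (r : ℝ≥0∞) (μ : Measure α) : Prop :=
  AEStronglyMeasurable f μ ∧ lorentzQuasiNorm f p r μ < ∞

end LorentzSpaces

/-! ## The half-space `ℝ^n_+`, `n = m + 1`, whose boundary is identified with `ℝ^m` -/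

/-- The open half-space `{x ∈ ℝ^{m+1} : x_{m+1} > 0}`. -/
def upperHalfSpace (m : ℕ) : Set (EuclideanSpace ℝ (Fin (m + 1))) :=
  {x | 0 < x (Fin.last m)}

/-- The boundary point `(y', 0)`, for `y' ∈ ℝ^m`. -/
def boundaryPoint {m : ℕ} (y' : EuclideanSpace ℝ (Fin m)) : EuclideanSpace ℝ (Fin (m + 1)) :=
  WithLp.toLp 2 (Fin.snoc (α := fun _ => ℝ) (fun i => y' i) 0)

/-- The reflection `y^* = (y', -y_{m+1})` of `y = (y', y_{m+1})`. -/
def reflectedPoint {m : ℕ} (y : EuclideanSpace ℝ (Fin (m + 1))) :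
    EuclideanSpace ℝ (Fin (m + 1)) :=
  WithLp.toLp 2 (Fin.snoc (α := fun _ => ℝ) (fun i => y i.castSucc) (-y (Fin.last m)))

/-- The heat fundamental solution of the half-space (Neumann condition),
`G(x,y,t) = (4πt)^{-n/2} [exp(-|x-y|²/(4t)) + exp(-|x-y^*|²/(4t))]` with `n = m + 1`. -/
def halfSpaceHeatKernel {m : ℕ} (x y : EuclideanSpace ℝ (Fin (m + 1))) (t : ℝ) : ℝ :=
  (4 * Real.pi * t) ^ (-((m : ℝ) + 1) / 2) *
    (Real.exp (-‖x - y‖ ^ 2 / (4 * t)) + Real.exp (-‖x - reflectedPoint y‖ ^ 2 / (4 * t)))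

/-- The boundary operator `𝒢₁ψ(x,t) = ∫_{∂ℝ^n_+} G(x,y',t) ψ(y') dy'`. -/
def boundaryOperator {m : ℕ} (ψ : EuclideanSpace ℝ (Fin m) → ℝ)
    (x : EuclideanSpace ℝ (Fin (m + 1))) (t : ℝ) : ℝ :=
  ∫ y' : EuclideanSpace ℝ (Fin m), halfSpaceHeatKernel x (boundaryPoint y') t * ψ y'

end

/-! ### Rearrangements, and `f**` as a K-functional between `L¹` and `L^∞`. -/

section Rearrangement

variable {α : Type*} [MeasurableSpace α] {μ : Measure α}

/-! The operator has a positive kernel `k`, and only three of its size bounds matter: `∫ k(x,·) ≤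
A`, `∫ k(·,y) ≤ A l` and `k ≤ A / a`. On the boundary the two exponentials of `G` coincide, so
Gaussian integrals give `A = 2(4πt)^(-1/2)`, `a = (4πt)^(m/2)`, and `l = 1` on the boundary or `l =
(4πt)^(1/2)` on the half-space.

The bridge to Lorentz norms is `s f**(s) = min_c (s c + ∫ (|f| - c)₊)`, attained at `c = f*(s)`.
Splitting `|f| ≤ c + (|f| - c)₊` at a well-chosen level turns the bounds on the kernel into `u**(s)
≤ A f**(max(s/l, a))`: the `L^∞` and `L¹` operator bounds give the argument `s/l`
(`averagedRearrangement_le_of_kernel`), the sup bound on `k` gives the argument `a`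
(`lintegral_kernel_mul_enorm_le`).

It remains to take Lorentz functionals in `s`. The dilation by `l` costs `l^(1/d₂)`, and freezing
the antitone `f**` below `a` allows passing from `d₁` to `d₂` at the price `(d₂/d₁) a^(1/d₂ - 1/d₁)`
(`lorentzFunctional_comp_max_le`). Multiplying the powers of `t` gives the stated exponents; no
interpolation theorem is used.

Membership is defined through `f*` and the estimate through `f**`. Finiteness is obtained without
Hardy's inequality: `f ∈ L^(d₁,r)` forces `f**(s) ≤ K s^(-1/d₁)`, which suffices since `d₁ < d₂` and
the argument never drops below `a`. -/

theorem volume_setOf_ofReal_lt_inter_Ioi (b : ℝ≥0∞) :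
    volume ({t : ℝ | ENNReal.ofReal t < b} ∩ Ioi 0) = b := by
  induction b with
  | top =>
    have : {t : ℝ | ENNReal.ofReal t < ∞} ∩ Ioi 0 = Ioi 0 := by ext; simp
    rw [this, Real.volume_Ioi]
  | coe b =>
    have : {t : ℝ | ENNReal.ofReal t < (b : ℝ≥0∞)} ∩ Ioi 0 = Ioo 0 (b : ℝ) := by
      ext t
      simp only [mem_inter_iff, mem_ofPred_eq, mem_Ioi, mem_Ioo]
      rw [← ENNReal.ofReal_coe_nnreal]
      constructor
      · rintro ⟨h, h0⟩
        exact ⟨h0, (ENNReal.ofReal_lt_ofReal_iff_of_nonneg h0.le).1 h⟩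
      · rintro ⟨h0, h⟩
        exact ⟨(ENNReal.ofReal_lt_ofReal_iff_of_nonneg h0.le).2 h, h0⟩
    rw [this, Real.volume_Ioo, sub_zero, ENNReal.ofReal_coe_nnreal]

/-- The layer cake formula for `ℝ≥0∞`-valued functions. -/
theorem lintegral_eq_lintegral_measure_ofReal_lt [SFinite μ] {f : α → ℝ≥0∞}
    (hf : AEMeasurable f μ) :
    ∫⁻ x, f x ∂μ = ∫⁻ t in Ioi (0 : ℝ), μ {x | ENNReal.ofReal t < f x} := by
  wlog hm : Measurable f generalizing f with H
  · rw [lintegral_congr_ae hf.ae_eq_mk, H hf.measurable_mk.aemeasurable hf.measurable_mk]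
    refine lintegral_congr fun t => measure_congr ?_
    filter_upwards [hf.ae_eq_mk] with x hx
    exact congrArg (ENNReal.ofReal t < ·) hx.symm
  have hS : MeasurableSet {p : α × ℝ | ENNReal.ofReal p.2 < f p.1} :=
    measurableSet_lt (by fun_prop) (by fun_prop)
  calc ∫⁻ x, f x ∂μ
      = ∫⁻ x, (∫⁻ t in Ioi (0 : ℝ),
          {p : α × ℝ | ENNReal.ofReal p.2 < f p.1}.indicator 1 (x, t)) ∂μ := by
        refine lintegral_congr fun x => ?_
        have hx : MeasurableSet {t : ℝ | ENNReal.ofReal t < f x} :=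
          measurableSet_lt (by fun_prop) (by fun_prop)
        conv_lhs => rw [← volume_setOf_ofReal_lt_inter_Ioi (f x)]
        rw [← Measure.restrict_apply hx, ← lintegral_indicator_one hx]
        rfl
    _ = ∫⁻ t in Ioi (0 : ℝ), (∫⁻ x,
          {p : α × ℝ | ENNReal.ofReal p.2 < f p.1}.indicator 1 (x, t) ∂μ) :=
        lintegral_lintegral_swap ((measurable_one.indicator hS).aemeasurable)
    _ = _ := by
        refine lintegral_congr fun t => ?_
        have ht : MeasurableSet {x | ENNReal.ofReal t < f x} :=
          measurableSet_lt (by fun_prop) hm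
        rw [← lintegral_indicator_one ht]
        rfl

theorem lintegral_enorm_sub_eq [SFinite μ] {f : α → ℝ} (hf : AEStronglyMeasurable f μ)
    (c : ℝ≥0∞) :
    ∫⁻ x, (‖f x‖ₑ - c) ∂μ
      = ∫⁻ t in Ioi (0 : ℝ), distributionFunction f μ (c + ENNReal.ofReal t) := by
  rw [lintegral_eq_lintegral_measure_ofReal_lt (hf.enorm.sub_const c)]
  simp only [lt_tsub_iff_left, distributionFunction]

theorem distributionFunction_antitone (f : α → ℝ) (μ : Measure α) :
    Antitone (distributionFunction f μ) :=
  fun _ _ h => measure_mono fun _ hx => lt_of_le_of_lt h hx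

theorem decreasingRearrangement_antitone (f : α → ℝ) (μ : Measure α) :
    Antitone (decreasingRearrangement f μ) :=
  fun _ _ h => sInf_le_sInf fun _ hs => ⟨hs.1, hs.2.trans (ENNReal.ofReal_le_ofReal h)⟩

theorem distributionFunction_le_of_decreasingRearrangement_lt {f : α → ℝ} {t : ℝ} {s : ℝ≥0∞}
    (h : decreasingRearrangement f μ t < s) :
    distributionFunction f μ s ≤ ENNReal.ofReal t := by
  obtain ⟨τ, hτ, hlt⟩ := sInf_lt_iff.1 h
  exact (distributionFunction_antitone f μ hlt.le).trans hτ.2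

/-- The distribution function is right-continuous, by continuity of measure from below along levels
decreasing to `s`; so the strict inequality in the previous lemma can be relaxed. -/
theorem distributionFunction_le_of_decreasingRearrangement_le {f : α → ℝ} {t : ℝ} {s : ℝ≥0∞}
    (h : decreasingRearrangement f μ t ≤ s) :
    distributionFunction f μ s ≤ ENNReal.ofReal t := by
  rcases eq_or_ne s ∞ with rfl | hs
  · simp [distributionFunction]
  obtain ⟨u, hu, hus, hlim⟩ := exists_seq_strictAnti_tendsto' (lt_top_iff_ne_top.2 hs)
  have hU : {x | s < ‖f x‖ₑ} = ⋃ n, {x | u n < ‖f x‖ₑ} := by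
    ext x
    simp only [mem_ofPred_eq, mem_iUnion]
    constructor
    · intro hx
      exact (hlim.eventually (gt_mem_nhds hx)).exists
    · rintro ⟨n, hn⟩
      exact (hus n).1.trans hn
  have hmono : Monotone fun n => {x | u n < ‖f x‖ₑ} :=
    fun i j hij x hx => lt_of_le_of_lt (hu.antitone hij) hx
  rw [distributionFunction, hU, hmono.measure_iUnion]
  exact iSup_le fun n =>
    distributionFunction_le_of_decreasingRearrangement_lt (h.trans_lt (hus n).1)

theorem decreasingRearrangement_le_of_distributionFunction_le {f : α → ℝ} {t : ℝ} {s : ℝ≥0∞}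
    (hs : 0 < s) (h : distributionFunction f μ s ≤ ENNReal.ofReal t) :
    decreasingRearrangement f μ t ≤ s :=
  sInf_le ⟨hs, h⟩

/-- By layer cake on both sides it is enough to compare level sets: `f*(v) > c + t` forces `v <
λ_f(c + t)`. -/
theorem setLIntegral_decreasingRearrangement_sub_le [SFinite μ] {f : α → ℝ}
    (hf : AEStronglyMeasurable f μ) (c : ℝ≥0∞) (s : ℝ) :
    ∫⁻ v in Ioo 0 s, (decreasingRearrangement f μ v - c) ≤ ∫⁻ x, (‖f x‖ₑ - c) ∂μ := by
  rw [lintegral_enorm_sub_eq hf, lintegral_eq_lintegral_measure_ofReal_lt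
    ((decreasingRearrangement_antitone f μ).measurable.sub_const c).aemeasurable]
  refine setLIntegral_mono' measurableSet_Ioi fun t ht => ?_
  have hm : MeasurableSet {v | ENNReal.ofReal t < decreasingRearrangement f μ v - c} :=
    measurableSet_lt measurable_const
      ((decreasingRearrangement_antitone f μ).measurable.sub_const c)
  rw [Measure.restrict_apply hm]
  conv_rhs => rw [← volume_setOf_ofReal_lt_inter_Ioi (distributionFunction f μ _)]
  refine measure_mono fun v hv => ⟨?_, hv.2.1⟩
  have hv1 : ENNReal.ofReal t < decreasingRearrangement f μ v - c := hv.1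
  by_contra hlt
  refine absurd (lt_tsub_iff_left.1 hv1) (not_lt.2 ?_)
  exact decreasingRearrangement_le_of_distributionFunction_le
    ((ENNReal.ofReal_pos.2 ht).trans_le le_add_self) (not_lt.1 hlt)

/-- The previous comparison reverses at the level `c = f*(s)`: since `λ_f(c + t) ≤ λ_f(c) ≤ s`, the
whole interval `(0, λ_f(c + t))` lies in `(0, s)`. -/
theorem lintegral_enorm_sub_decreasingRearrangement_le [SFinite μ] {f : α → ℝ}
    (hf : AEStronglyMeasurable f μ) (s : ℝ) :
    ∫⁻ x, (‖f x‖ₑ - decreasingRearrangement f μ s) ∂μ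
      ≤ ∫⁻ v in Ioo 0 s, (decreasingRearrangement f μ v - decreasingRearrangement f μ s) := by
  set c := decreasingRearrangement f μ s with hc
  rcases eq_or_ne c ∞ with hct | hct
  · simp [hct]
  rw [lintegral_enorm_sub_eq hf, lintegral_eq_lintegral_measure_ofReal_lt
    ((decreasingRearrangement_antitone f μ).measurable.sub_const c).aemeasurable]
  refine setLIntegral_mono' measurableSet_Ioi fun t ht => ?_
  have hm : MeasurableSet {v | ENNReal.ofReal t < decreasingRearrangement f μ v - c} :=
    measurableSet_lt measurable_const
      ((decreasingRearrangement_antitone f μ).measurable.sub_const c)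
  rw [Measure.restrict_apply hm]
  conv_lhs => rw [← volume_setOf_ofReal_lt_inter_Ioi (distributionFunction f μ _)]
  have hds : distributionFunction f μ (c + ENNReal.ofReal t) ≤ ENNReal.ofReal s :=
    distributionFunction_le_of_decreasingRearrangement_le le_self_add
  refine measure_mono fun v hv => ⟨?_, hv.2, ?_⟩
  · change ENNReal.ofReal t < decreasingRearrangement f μ v - c
    refine lt_tsub_iff_left.2 ?_
    by_contra hlt
    exact absurd hv.1 (not_lt.2
      (distributionFunction_le_of_decreasingRearrangement_le (not_lt.1 hlt)))
  · exact (ENNReal.ofReal_lt_ofReal_iff_of_nonneg (le_of_lt hv.2)).1 (hv.1.trans_le hds)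

/-- The half of the K-functional formula saying that the level `f*(s)` attains the minimum. -/
theorem ofReal_mul_decreasingRearrangement_add_lintegral_le [SFinite μ] {f : α → ℝ}
    (hf : AEStronglyMeasurable f μ) (s : ℝ) :
    ENNReal.ofReal s * decreasingRearrangement f μ s
        + ∫⁻ x, (‖f x‖ₑ - decreasingRearrangement f μ s) ∂μ
      ≤ ∫⁻ v in Ioo 0 s, decreasingRearrangement f μ v := by
  set c := decreasingRearrangement f μ s with hc
  calc _ ≤ ENNReal.ofReal s * c + ∫⁻ v in Ioo 0 s, (decreasingRearrangement f μ v - c) := by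
        gcongr
        exact lintegral_enorm_sub_decreasingRearrangement_le hf s
    _ = ∫⁻ v in Ioo 0 s, (c + (decreasingRearrangement f μ v - c)) := by
        rw [lintegral_add_left measurable_const, setLIntegral_const, Real.volume_Ioo, sub_zero,
          mul_comm]
    _ = _ := by
        refine setLIntegral_congr_fun measurableSet_Ioo fun v hv => ?_
        exact add_tsub_cancel_of_le (decreasingRearrangement_antitone f μ hv.2.le)

/-- The other half of the K-functional formula: every level `c` gives an upper bound. -/
theorem setLIntegral_decreasingRearrangement_le [SFinite μ] {f : α → ℝ}
    (hf : AEStronglyMeasurable f μ) (c : ℝ≥0∞) (s : ℝ) :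
    ∫⁻ v in Ioo 0 s, decreasingRearrangement f μ v
      ≤ ENNReal.ofReal s * c + ∫⁻ x, (‖f x‖ₑ - c) ∂μ := by
  calc _ ≤ ∫⁻ v in Ioo 0 s, (c + (decreasingRearrangement f μ v - c)) :=
        lintegral_mono fun v => le_add_tsub
    _ = ENNReal.ofReal s * c + ∫⁻ v in Ioo 0 s, (decreasingRearrangement f μ v - c) := by
        rw [lintegral_add_left measurable_const, setLIntegral_const, Real.volume_Ioo, sub_zero,
          mul_comm]
    _ ≤ _ := by
        gcongr
        exact setLIntegral_decreasingRearrangement_sub_le hf c s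

theorem decreasingRearrangement_le_averagedRearrangement (f : α → ℝ) (μ : Measure α) {t : ℝ}
    (ht : 0 < t) : decreasingRearrangement f μ t ≤ averagedRearrangement f μ t := by
  rw [averagedRearrangement, ENNReal.le_div_iff_mul_le (by simp [ht]) (by simp)]
  calc _ = ∫⁻ _ in Ioo 0 t, decreasingRearrangement f μ t := by
        rw [setLIntegral_const, Real.volume_Ioo, sub_zero]
    _ ≤ _ := setLIntegral_mono' measurableSet_Ioo fun v hv =>
        decreasingRearrangement_antitone f μ hv.2.le

/-- `f**(t)` is a minimum over `c` of `c + (1/t) ∫ (|f| - c)₊`, each antitone in `t`; the level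
optimal for `s` is tested at `t`. -/
theorem averagedRearrangement_antitoneOn {f : α → ℝ} [SFinite μ]
    (hf : AEStronglyMeasurable f μ) : AntitoneOn (averagedRearrangement f μ) (Ioi 0) := by
  intro s hs t ht hst
  rw [mem_Ioi] at hs ht
  have hs' : ENNReal.ofReal s ≠ 0 := by simp [hs]
  rw [averagedRearrangement, averagedRearrangement,
    ENNReal.div_le_iff (by simp [ht]) (by simp)]
  set c := decreasingRearrangement f μ s
  calc _ ≤ ENNReal.ofReal t * c + ∫⁻ x, (‖f x‖ₑ - c) ∂μ :=
        setLIntegral_decreasingRearrangement_le hf c t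
    _ ≤ ENNReal.ofReal t * c + ENNReal.ofReal t / ENNReal.ofReal s * ∫⁻ x, (‖f x‖ₑ - c) ∂μ := by
        gcongr
        refine le_mul_of_one_le_left zero_le ?_
        rw [ENNReal.le_div_iff_mul_le (by simp [hs]) (by simp), one_mul]
        exact ENNReal.ofReal_le_ofReal hst
    _ = ENNReal.ofReal t / ENNReal.ofReal s *
          (ENNReal.ofReal s * c + ∫⁻ x, (‖f x‖ₑ - c) ∂μ) := by
        rw [mul_add, ← mul_assoc, ENNReal.div_mul_cancel hs' (by simp)]
    _ ≤ ENNReal.ofReal t / ENNReal.ofReal s * ∫⁻ v in Ioo 0 s, decreasingRearrangement f μ v := by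
        gcongr
        exact ofReal_mul_decreasingRearrangement_add_lintegral_le hf s
    _ = _ := by simp only [div_eq_mul_inv]; ring

end Rearrangement

/-! ### Pointwise bounds on `u**` from bounds on the kernel. -/

section IntegralOperator

variable {α β : Type*} [MeasurableSpace α] [MeasurableSpace β] {μ : Measure α} {ν : Measure β}

/-- A kernel with `∫ k(x,·) ≤ A` and `k ≤ B` maps into `L^∞`, with bound given by the averaged
rearrangement at `A / B`. -/
theorem lintegral_kernel_mul_enorm_le [SFinite μ] {f : α → ℝ} (hf : AEStronglyMeasurable f μ)
    {k : α → ℝ≥0∞} (hk : Measurable k) {A : ℝ≥0∞} {a : ℝ} (ha : 0 < a)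
    (hA : ∫⁻ y, k y ∂μ ≤ A) (hB : ∀ y, k y ≤ A / ENNReal.ofReal a) :
    ∫⁻ y, k y * ‖f y‖ₑ ∂μ ≤ A * averagedRearrangement f μ a := by
  -- After splitting `|f| ≤ c + (|f| - c)₊`, the constant uses `∫ k ≤ A` and the excess uses `k ≤ A
  -- / a`; this `c` makes the sum `(A / a)(a c + ∫ (|f| - c)₊)` minimal.
  set c := decreasingRearrangement f μ a
  have ha' : ENNReal.ofReal a ≠ 0 := by simp [ha]
  calc ∫⁻ y, k y * ‖f y‖ₑ ∂μ ≤ ∫⁻ y, (k y * c + A / ENNReal.ofReal a * (‖f y‖ₑ - c)) ∂μ := by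
        refine lintegral_mono fun y => ?_
        calc k y * ‖f y‖ₑ ≤ k y * (c + (‖f y‖ₑ - c)) := by gcongr; exact le_add_tsub
          _ = k y * c + k y * (‖f y‖ₑ - c) := mul_add _ _ _
          _ ≤ _ := by gcongr; exact hB y
    _ = (∫⁻ y, k y ∂μ) * c + A / ENNReal.ofReal a * ∫⁻ y, (‖f y‖ₑ - c) ∂μ := by
        rw [lintegral_add_left (hk.mul_const c), lintegral_mul_const _ hk,
          lintegral_const_mul'' _ (hf.enorm.sub_const c)]
    _ ≤ A * c + A / ENNReal.ofReal a * ∫⁻ y, (‖f y‖ₑ - c) ∂μ := by gcongr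
    _ = A / ENNReal.ofReal a * (ENNReal.ofReal a * c + ∫⁻ y, (‖f y‖ₑ - c) ∂μ) := by
        rw [mul_add, ← mul_assoc, ENNReal.div_mul_cancel ha' (by simp)]
    _ ≤ A / ENNReal.ofReal a * ∫⁻ v in Ioo 0 a, decreasingRearrangement f μ v := by
        gcongr
        exact ofReal_mul_decreasingRearrangement_add_lintegral_le hf a
    _ = _ := by rw [averagedRearrangement]; simp only [div_eq_mul_inv]; ring

/-- An integral operator bounded on `L^∞` with norm `A` and on `L¹` with norm `A * l`. -/
theorem averagedRearrangement_le_of_kernel [SFinite μ] [SFinite ν] {f : α → ℝ}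
    (hf : AEStronglyMeasurable f μ) {u : β → ℝ} (hu : AEStronglyMeasurable u ν)
    {k : β → α → ℝ≥0∞} (hk : Measurable (Function.uncurry k)) {A : ℝ≥0∞} {l : ℝ} (hl : 0 < l)
    (hA : ∀ x, ∫⁻ y, k x y ∂μ ≤ A) (hB : ∀ y, ∫⁻ x, k x y ∂ν ≤ A * ENNReal.ofReal l)
    (huk : ∀ x, ‖u x‖ₑ ≤ ∫⁻ y, k x y * ‖f y‖ₑ ∂μ) {s : ℝ} (hs : 0 < s) :
    averagedRearrangement u ν s ≤ A * averagedRearrangement f μ (s / l) := by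
  -- The level for `u` will be `A c`; the resulting bound is `A l ((s/l) c + ∫ (|f| - c)₊)`, for
  -- which `f*(s/l)` is the optimal level.
  set c := decreasingRearrangement f μ (s / l)
  have hkx : ∀ x, Measurable (k x) := fun x => hk.comp measurable_prodMk_left
  have hky : ∀ y, Measurable fun x => k x y := fun y => hk.comp measurable_prodMk_right
  have hl' : ENNReal.ofReal l ≠ 0 := by simp [hl]
  have hfc : AEMeasurable (fun y => ‖f y‖ₑ - c) μ := hf.enorm.sub_const c
  have h1 : ∀ x, ‖u x‖ₑ - A * c ≤ ∫⁻ y, k x y * (‖f y‖ₑ - c) ∂μ := by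
    intro x
    rw [tsub_le_iff_left]
    calc ‖u x‖ₑ ≤ ∫⁻ y, k x y * ‖f y‖ₑ ∂μ := huk x
      _ ≤ ∫⁻ y, (k x y * c + k x y * (‖f y‖ₑ - c)) ∂μ := by
          refine lintegral_mono fun y => ?_
          rw [← mul_add]
          gcongr
          exact le_add_tsub
      _ = (∫⁻ y, k x y ∂μ) * c + ∫⁻ y, k x y * (‖f y‖ₑ - c) ∂μ := by
          rw [lintegral_add_left ((hkx x).mul_const c), lintegral_mul_const _ (hkx x)]
      _ ≤ _ := by gcongr; exact hA x
  have h2 : ∫⁻ x, (‖u x‖ₑ - A * c) ∂ν ≤ A * ENNReal.ofReal l * ∫⁻ y, (‖f y‖ₑ - c) ∂μ :=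
    calc _ ≤ ∫⁻ x, ∫⁻ y, k x y * (‖f y‖ₑ - c) ∂μ ∂ν := lintegral_mono h1
      _ = ∫⁻ y, ∫⁻ x, k x y * (‖f y‖ₑ - c) ∂ν ∂μ := by
          refine lintegral_lintegral_swap (hk.aemeasurable.mul ?_)
          exact hfc.comp_quasiMeasurePreserving Measure.quasiMeasurePreserving_snd
      _ = ∫⁻ y, (∫⁻ x, k x y ∂ν) * (‖f y‖ₑ - c) ∂μ :=
          lintegral_congr fun y => lintegral_mul_const _ (hky y)
      _ ≤ ∫⁻ y, A * ENNReal.ofReal l * (‖f y‖ₑ - c) ∂μ := by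
          refine lintegral_mono fun y => ?_
          gcongr
          exact hB y
      _ = _ := lintegral_const_mul'' _ hfc
  have hsl : ENNReal.ofReal s = ENNReal.ofReal l * ENNReal.ofReal (s / l) := by
    rw [← ENNReal.ofReal_mul hl.le, mul_div_cancel₀ _ hl.ne']
  have hsl' : ENNReal.ofReal (s / l) ≠ 0 := by simp [div_pos hs hl]
  rw [averagedRearrangement, ENNReal.div_le_iff (by simp [hs]) (by simp)]
  calc _ ≤ ENNReal.ofReal s * (A * c) + ∫⁻ x, (‖u x‖ₑ - A * c) ∂ν :=
        setLIntegral_decreasingRearrangement_le hu _ s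
    _ ≤ ENNReal.ofReal s * (A * c) + A * ENNReal.ofReal l * ∫⁻ y, (‖f y‖ₑ - c) ∂μ := by gcongr
    _ = A * ENNReal.ofReal l *
          (ENNReal.ofReal (s / l) * c + ∫⁻ y, (‖f y‖ₑ - c) ∂μ) := by rw [hsl]; ring
    _ ≤ A * ENNReal.ofReal l * ∫⁻ v in Ioo 0 (s / l), decreasingRearrangement f μ v := by
        gcongr
        exact ofReal_mul_decreasingRearrangement_add_lintegral_le hf _
    _ = A * ENNReal.ofReal l *
          (averagedRearrangement f μ (s / l) * ENNReal.ofReal (s / l)) := by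
        rw [averagedRearrangement, ENNReal.div_mul_cancel hsl' (by simp)]
    _ = _ := by rw [hsl]; ring

theorem averagedRearrangement_le_of_enorm_le [SFinite ν] {u : β → ℝ}
    (hu : AEStronglyMeasurable u ν) {M : ℝ≥0∞} (h : ∀ x, ‖u x‖ₑ ≤ M) {s : ℝ} (hs : 0 < s) :
    averagedRearrangement u ν s ≤ M := by
  rw [averagedRearrangement, ENNReal.div_le_iff (by simp [hs]) (by simp), mul_comm]
  refine (setLIntegral_decreasingRearrangement_le hu M s).trans (le_of_eq ?_)
  simp [tsub_eq_zero_of_le (h _)]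

end IntegralOperator

/-! ### Integrals of powers and dilations on the half-line. -/

section PowerIntegrals

theorem setLIntegral_Ioc_ofReal_rpow {e a : ℝ} (he : -1 < e) (ha : 0 < a) :
    ∫⁻ s in Ioc 0 a, ENNReal.ofReal s ^ e = ENNReal.ofReal a ^ (e + 1) / ENNReal.ofReal (e + 1) := by
  have he' : 0 < e + 1 := by linarith
  have hi : IntegrableOn (fun s : ℝ => s ^ e) (Ioc 0 a) :=
    (intervalIntegrable_iff_integrableOn_Ioc_of_le ha.le).1
      (intervalIntegral.intervalIntegrable_rpow' he)
  have h : ∫ s in Ioc 0 a, s ^ e = a ^ (e + 1) / (e + 1) := by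
    rw [← intervalIntegral.integral_of_le ha.le, integral_rpow (Or.inl he),
      Real.zero_rpow he'.ne', sub_zero]
  calc _ = ∫⁻ s in Ioc 0 a, ENNReal.ofReal (s ^ e) :=
        setLIntegral_congr_fun measurableSet_Ioc fun s hs => ENNReal.ofReal_rpow_of_pos hs.1
    _ = ENNReal.ofReal (∫ s in Ioc 0 a, s ^ e) := by
        refine (ofReal_integral_eq_lintegral_ofReal hi ?_).symm
        filter_upwards [ae_restrict_mem measurableSet_Ioc] with s hs
        exact Real.rpow_nonneg hs.1.le _
    _ = _ := by
        rw [h, ENNReal.ofReal_div_of_pos he', ENNReal.ofReal_rpow_of_pos ha]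

theorem setLIntegral_Ioi_ofReal_rpow_lt_top {e a : ℝ} (he : e < -1) (ha : 0 < a) :
    ∫⁻ s in Ioi a, ENNReal.ofReal s ^ e < ∞ := by
  calc _ = ∫⁻ s in Ioi a, ENNReal.ofReal (s ^ e) :=
        setLIntegral_congr_fun measurableSet_Ioi fun s hs =>
          ENNReal.ofReal_rpow_of_pos (ha.trans hs)
    _ = ENNReal.ofReal (∫ s in Ioi a, s ^ e) := by
        refine (ofReal_integral_eq_lintegral_ofReal (integrableOn_Ioi_rpow_of_lt he ha) ?_).symm
        filter_upwards [ae_restrict_mem measurableSet_Ioi] with s hs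
        exact Real.rpow_nonneg (ha.trans hs).le _
    _ < ∞ := ENNReal.ofReal_lt_top

theorem lintegral_Ioi_comp_mul_right {l : ℝ} (hl : 0 < l) (g : ℝ → ℝ≥0∞) :
    ∫⁻ t in Ioi (0 : ℝ), g t = ENNReal.ofReal l * ∫⁻ t in Ioi (0 : ℝ), g (t * l) := by
  have himg : (fun t : ℝ => t * l) '' Ioi 0 = Ioi 0 := by
    ext x
    refine ⟨?_, fun hx => ⟨x / l, div_pos hx hl, div_mul_cancel₀ x hl.ne'⟩⟩
    rintro ⟨y, hy, rfl⟩
    exact mul_pos hy hl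
  have := lintegral_image_eq_lintegral_abs_deriv_mul (f := fun t : ℝ => t * l) (f' := fun _ => l)
    (measurableSet_Ioi (a := (0 : ℝ)))
    (fun x _ => (hasDerivAt_mul_const l).hasDerivWithinAt)
    ((mul_left_injective₀ hl.ne').injOn) g
  rw [himg] at this
  rw [this, abs_of_pos hl, lintegral_const_mul' _ _ ENNReal.ofReal_ne_top]

end PowerIntegrals

/-! ### Dilation, truncation and finiteness of the Lorentz functional. -/

section LorentzFunctional

variable {p p₁ p₂ : ℝ} {r : ℝ≥0∞} {φ χ : ℝ → ℝ≥0∞}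

theorem ENNReal.one_le_toReal_of_one_le (hr : 1 ≤ r) (h : r ≠ ∞) : 1 ≤ r.toReal := by
  simpa using ENNReal.toReal_mono h hr

theorem lorentzFunctional_mono (h : ∀ t, 0 < t → φ t ≤ χ t) :
    lorentzFunctional p r φ ≤ lorentzFunctional p r χ := by
  unfold lorentzFunctional
  split_ifs
  · exact iSup₂_mono fun t ht => by gcongr; exact h t ht
  · refine ENNReal.rpow_le_rpow (setLIntegral_mono' measurableSet_Ioi fun t ht => ?_)
      (by positivity)
    gcongr
    exact h t ht

theorem lorentzFunctional_const_mul_le (hr : 1 ≤ r) {A : ℝ≥0∞} (hA : A ≠ ∞) :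
    lorentzFunctional p r (fun t => A * φ t) ≤ A * lorentzFunctional p r φ := by
  unfold lorentzFunctional
  split_ifs with h
  · refine iSup₂_le fun t ht => ?_
    rw [mul_left_comm]
    gcongr
    exact le_iSup₂ (f := fun (t : ℝ) (_ : t ∈ Ioi (0 : ℝ)) => ENNReal.ofReal t ^ (1 / p) * φ t) t ht
  · have hρ := ENNReal.one_le_toReal_of_one_le hr h
    set ρ := r.toReal
    have hρ0 : 0 ≤ ρ := by linarith
    have h1 : ∀ t : ℝ, (ENNReal.ofReal t ^ (1 / p) * (A * φ t)) ^ ρ / ENNReal.ofReal t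
        = A ^ ρ * ((ENNReal.ofReal t ^ (1 / p) * φ t) ^ ρ / ENNReal.ofReal t) := fun t => by
      rw [mul_left_comm, ENNReal.mul_rpow_of_nonneg _ _ hρ0, mul_div_assoc]
    simp only [h1]
    rw [lintegral_const_mul' _ _ (ENNReal.rpow_ne_top_of_nonneg hρ0 hA),
      ENNReal.mul_rpow_of_nonneg _ _ (by positivity), ← ENNReal.rpow_mul, mul_one_div_cancel
        (by linarith), ENNReal.rpow_one]

theorem ENNReal.ofReal_rpow_mul_rpow {t : ℝ} (ht : 0 < t) (x y : ℝ) :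
    ENNReal.ofReal t ^ x * ENNReal.ofReal t ^ y = ENNReal.ofReal t ^ (x + y) :=
  (ENNReal.rpow_add x y (by simp [ht]) (by simp)).symm

theorem ENNReal.ofReal_rpow_le_of_nonpos {a b z : ℝ} (ha : 0 < a) (hab : a ≤ b) (hz : z ≤ 0) :
    ENNReal.ofReal b ^ z ≤ ENNReal.ofReal a ^ z := by
  rw [ENNReal.ofReal_rpow_of_pos ha, ENNReal.ofReal_rpow_of_pos (ha.trans_le hab)]
  exact ENNReal.ofReal_le_ofReal (Real.rpow_le_rpow_of_nonpos ha hab hz)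

/-- Since `dt/t` is dilation invariant, only the weight `t^(1/p)` contributes a factor. -/
theorem lorentzFunctional_comp_div_le (hp : 0 < p) (hr : 1 ≤ r) {l : ℝ} (hl : 0 < l) :
    lorentzFunctional p r (fun t => φ (t / l))
      ≤ ENNReal.ofReal l ^ (1 / p) * lorentzFunctional p r φ := by
  have hp' : 0 ≤ 1 / p := by positivity
  unfold lorentzFunctional
  split_ifs with h
  · refine iSup₂_le fun t ht => ?_
    have ht' : t / l ∈ Ioi (0 : ℝ) := div_pos ht hl
    have hts : ENNReal.ofReal t = ENNReal.ofReal l * ENNReal.ofReal (t / l) := by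
      rw [← ENNReal.ofReal_mul hl.le, mul_div_cancel₀ _ hl.ne']
    rw [hts, ENNReal.mul_rpow_of_nonneg _ _ hp', mul_assoc]
    gcongr
    exact le_iSup₂ (f := fun (t : ℝ) (_ : t ∈ Ioi (0 : ℝ)) => ENNReal.ofReal t ^ (1 / p) * φ t) _ ht'
  · have hρ := ENNReal.one_le_toReal_of_one_le hr h
    set ρ := r.toReal
    have hρ0 : 0 ≤ ρ := by linarith
    have hl0 : ENNReal.ofReal l ≠ 0 := by simp [hl]
    have h1 : ∀ t ∈ Ioi (0 : ℝ),
        (ENNReal.ofReal (t * l) ^ (1 / p) * φ (t * l / l)) ^ ρ / ENNReal.ofReal (t * l)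
        = ((ENNReal.ofReal l ^ (1 / p)) ^ ρ * (ENNReal.ofReal l)⁻¹) *
          ((ENNReal.ofReal t ^ (1 / p) * φ t) ^ ρ / ENNReal.ofReal t) := fun t ht => by
      rw [mul_div_cancel_right₀ _ hl.ne', ENNReal.ofReal_mul (le_of_lt ht),
        ENNReal.mul_rpow_of_nonneg _ _ hp', mul_comm (ENNReal.ofReal t ^ (1 / p)), mul_assoc,
        ENNReal.mul_rpow_of_nonneg _ _ hρ0, ENNReal.div_eq_inv_mul, ENNReal.div_eq_inv_mul,
        ENNReal.mul_inv (by simp) (by simp)]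
      ring
    rw [lintegral_Ioi_comp_mul_right hl, setLIntegral_congr_fun measurableSet_Ioi h1,
      lintegral_const_mul' _ _ (ENNReal.mul_ne_top (ENNReal.rpow_ne_top_of_nonneg hρ0
        (ENNReal.rpow_ne_top_of_nonneg hp' (by simp))) (by simp [hl])), ← mul_assoc,
      mul_left_comm, ENNReal.mul_inv_cancel hl0 (by simp), mul_one,
      ENNReal.mul_rpow_of_nonneg _ _ (by positivity), ← ENNReal.rpow_mul, mul_one_div_cancel
        (by linarith), ENNReal.rpow_one]

theorem ofReal_rpow_mul_rpow_div {t : ℝ} (ht : 0 < t) {ρ : ℝ} (hρ : 0 ≤ ρ) (b : ℝ≥0∞) :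
    (ENNReal.ofReal t ^ (1 / p) * b) ^ ρ / ENNReal.ofReal t
      = ENNReal.ofReal t ^ (ρ / p - 1) * b ^ ρ := by
  rw [ENNReal.mul_rpow_of_nonneg _ _ hρ, ← ENNReal.rpow_mul,
    ENNReal.rpow_sub _ _ (by simp [ht]) (by simp), ENNReal.rpow_one, one_div_mul_eq_div]
  simp only [div_eq_mul_inv]
  ring

theorem rpow_mul_div_le_setLIntegral (hφ : AntitoneOn φ (Ioi 0)) {e ρ a : ℝ} (he : 0 < e)
    (hρ : 0 ≤ ρ) (ha : 0 < a) :
    ENNReal.ofReal a ^ e / ENNReal.ofReal e * φ a ^ ρ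
      ≤ ∫⁻ s in Ioc 0 a, ENNReal.ofReal s ^ (e - 1) * φ s ^ ρ := by
  calc _ = ∫⁻ s in Ioc 0 a, ENNReal.ofReal s ^ (e - 1) * φ a ^ ρ := by
        rw [lintegral_mul_const _ (by fun_prop), setLIntegral_Ioc_ofReal_rpow (by linarith) ha,
          sub_add_cancel]
    _ ≤ _ := by
        refine setLIntegral_mono' measurableSet_Ioc fun s hs => ?_
        gcongr
        exact hφ hs.1 (mem_Ioi.2 ha) hs.2

theorem setLIntegral_Ioi_zero_eq_add {a : ℝ} (ha : 0 < a) (g : ℝ → ℝ≥0∞) :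
    ∫⁻ s in Ioi 0, g s = (∫⁻ s in Ioc 0 a, g s) + ∫⁻ s in Ioi a, g s := by
  rw [← lintegral_union measurableSet_Ioi Ioc_disjoint_Ioi_same, Ioc_union_Ioi_eq_Ioi ha.le]

/-- Above `a` the ratio of the weights, `s^(1/p₂ - 1/p₁)`, is at most its value at `a`. Below `a`
the function is the constant `φ a`, which monotonicity bounds by the `p₁`-integral over `(0, a]`. -/
theorem lorentzFunctional_comp_max_le (hp₁ : 0 < p₁) (hp : p₁ < p₂) (hr : 1 ≤ r)
    (hφ : AntitoneOn φ (Ioi 0)) {a : ℝ} (ha : 0 < a) :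
    lorentzFunctional p₂ r (fun t => φ (max t a))
      ≤ ENNReal.ofReal (p₂ / p₁) * ENNReal.ofReal a ^ (1 / p₂ - 1 / p₁)
          * lorentzFunctional p₁ r φ := by
  have hp₂ : 0 < p₂ := hp₁.trans hp
  have hexp : 1 / p₂ - 1 / p₁ ≤ 0 := by
    have := one_div_le_one_div_of_le hp₁ hp.le
    linarith
  have hC : 1 ≤ ENNReal.ofReal (p₂ / p₁) := by
    rw [ENNReal.one_le_ofReal, one_le_div hp₁]
    exact hp.le
  unfold lorentzFunctional
  split_ifs with h
  · refine iSup₂_le fun t ht => ?_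
    have hm : 0 < max t a := lt_max_of_lt_right ha
    calc ENNReal.ofReal t ^ (1 / p₂) * φ (max t a)
        ≤ ENNReal.ofReal (max t a) ^ (1 / p₂) * φ (max t a) := by
          gcongr
          exact le_max_left _ _
      _ = ENNReal.ofReal (max t a) ^ (1 / p₂ - 1 / p₁)
          * (ENNReal.ofReal (max t a) ^ (1 / p₁) * φ (max t a)) := by
          rw [← mul_assoc, ENNReal.ofReal_rpow_mul_rpow hm, sub_add_cancel]
      _ ≤ ENNReal.ofReal a ^ (1 / p₂ - 1 / p₁) * _ := by
          refine mul_le_mul' ?_ (le_iSup₂ (f := fun (t : ℝ) (_ : t ∈ Ioi (0 : ℝ)) =>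
            ENNReal.ofReal t ^ (1 / p₁) * φ t) _ hm)
          exact ENNReal.ofReal_rpow_le_of_nonpos ha (le_max_right _ _) hexp
      _ ≤ _ := by
          gcongr
          exact le_mul_of_one_le_left zero_le hC
  · have hρ := ENNReal.one_le_toReal_of_one_le hr h
    set ρ := r.toReal
    have hρ0 : 0 < ρ := by linarith
    have he₁ : 0 < ρ / p₁ := by positivity
    have he₂ : 0 < ρ / p₂ := by positivity
    have hee : ρ / p₂ - ρ / p₁ ≤ 0 := by
      have : ρ / p₂ - ρ / p₁ = ρ * (1 / p₂ - 1 / p₁) := by ring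
      rw [this]
      exact mul_nonpos_of_nonneg_of_nonpos hρ0.le hexp
    -- The quotient of `∫_0^a s^(ρ/p₂ - 1) ds` by `∫_0^a s^(ρ/p₁ - 1) ds`. The tail would need only
    -- the power of `a`.
    set D := ENNReal.ofReal (p₂ / p₁) * ENNReal.ofReal a ^ (ρ / p₂ - ρ / p₁)
    have hD : D ≠ ∞ := ENNReal.mul_ne_top (by simp)
      (ENNReal.rpow_ne_top_of_ne_zero (by simp [ha]) (by simp))
    have hlow : ∫⁻ s in Ioc 0 a, ENNReal.ofReal s ^ (ρ / p₂ - 1) * φ (max s a) ^ ρ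
        ≤ D * ∫⁻ s in Ioc 0 a, ENNReal.ofReal s ^ (ρ / p₁ - 1) * φ s ^ ρ := by
      calc _ = ∫⁻ s in Ioc 0 a, ENNReal.ofReal s ^ (ρ / p₂ - 1) * φ a ^ ρ :=
            setLIntegral_congr_fun measurableSet_Ioc fun s hs => by
              simp only [max_eq_right hs.2]
        _ = ENNReal.ofReal a ^ (ρ / p₂) / ENNReal.ofReal (ρ / p₂) * φ a ^ ρ := by
            rw [lintegral_mul_const _ (by fun_prop),
              setLIntegral_Ioc_ofReal_rpow (by linarith) ha, sub_add_cancel]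
        _ = D * (ENNReal.ofReal a ^ (ρ / p₁) / ENNReal.ofReal (ρ / p₁) * φ a ^ ρ) := by
            have h1 : ENNReal.ofReal a ^ (ρ / p₂)
                = ENNReal.ofReal a ^ (ρ / p₂ - ρ / p₁) * ENNReal.ofReal a ^ (ρ / p₁) := by
              rw [ENNReal.ofReal_rpow_mul_rpow ha, sub_add_cancel]
            have h2 : (ENNReal.ofReal (ρ / p₂))⁻¹
                = ENNReal.ofReal (p₂ / p₁) * (ENNReal.ofReal (ρ / p₁))⁻¹ := by
              rw [← ENNReal.ofReal_inv_of_pos he₂, ← ENNReal.ofReal_inv_of_pos he₁,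
                ← ENNReal.ofReal_mul (by positivity)]
              congr 1
              field_simp
            simp only [ENNReal.div_eq_inv_mul, D]
            rw [h1, h2]
            ring
        _ ≤ _ := by
            gcongr
            exact rpow_mul_div_le_setLIntegral hφ he₁ hρ0.le ha
    have hhigh : ∫⁻ s in Ioi a, ENNReal.ofReal s ^ (ρ / p₂ - 1) * φ (max s a) ^ ρ
        ≤ D * ∫⁻ s in Ioi a, ENNReal.ofReal s ^ (ρ / p₁ - 1) * φ s ^ ρ := by
      rw [← lintegral_const_mul' _ _ hD]
      refine setLIntegral_mono' measurableSet_Ioi fun s hs => ?_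
      have hs' : a < s := hs
      rw [max_eq_left hs'.le, ← mul_assoc]
      gcongr
      calc ENNReal.ofReal s ^ (ρ / p₂ - 1)
          = ENNReal.ofReal s ^ (ρ / p₂ - ρ / p₁) * ENNReal.ofReal s ^ (ρ / p₁ - 1) := by
            rw [ENNReal.ofReal_rpow_mul_rpow (ha.trans hs')]
            congr 1
            ring
        _ ≤ D * _ := by
            gcongr
            calc ENNReal.ofReal s ^ (ρ / p₂ - ρ / p₁)
                ≤ ENNReal.ofReal a ^ (ρ / p₂ - ρ / p₁) :=
                  ENNReal.ofReal_rpow_le_of_nonpos ha hs'.le hee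
              _ ≤ D := le_mul_of_one_le_left zero_le hC
    have hI : ∀ (q : ℝ) (χ : ℝ → ℝ≥0∞),
        ∫⁻ t in Ioi (0 : ℝ), (ENNReal.ofReal t ^ (1 / q) * χ t) ^ ρ / ENNReal.ofReal t
        = ∫⁻ t in Ioi (0 : ℝ), ENNReal.ofReal t ^ (ρ / q - 1) * χ t ^ ρ := fun q χ =>
      setLIntegral_congr_fun measurableSet_Ioi fun t ht => ofReal_rpow_mul_rpow_div ht hρ0.le _
    -- As `p₂ / p₁ ≥ 1` and `1 / ρ ≤ 1`, dropping the root makes the constant independent of `r`.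
    have hDρ : D ^ (1 / ρ) ≤ ENNReal.ofReal (p₂ / p₁) * ENNReal.ofReal a ^ (1 / p₂ - 1 / p₁) := by
      rw [ENNReal.mul_rpow_of_nonneg _ _ (by positivity), ← ENNReal.rpow_mul,
        show (ρ / p₂ - ρ / p₁) * (1 / ρ) = 1 / p₂ - 1 / p₁ by field_simp]
      gcongr
      calc _ ≤ ENNReal.ofReal (p₂ / p₁) ^ (1 : ℝ) :=
            ENNReal.rpow_le_rpow_of_exponent_le hC ((div_le_one hρ0).2 hρ)
        _ = _ := ENNReal.rpow_one _
    rw [hI p₂ fun t => φ (max t a), hI p₁]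
    calc _ ≤ (D * ∫⁻ t in Ioi (0 : ℝ), ENNReal.ofReal t ^ (ρ / p₁ - 1) * φ t ^ ρ) ^ (1 / ρ) := by
          gcongr
          rw [setLIntegral_Ioi_zero_eq_add ha, setLIntegral_Ioi_zero_eq_add ha, mul_add]
          gcongr
      _ ≤ _ := by
          rw [ENNReal.mul_rpow_of_nonneg _ _ (by positivity)]
          gcongr

/-- Weak-type decay is enough here: truncation removes the singularity at `0`, and `p₁ < p₂` makes
the tail converge (or stay bounded when `r = ∞`). -/
theorem lorentzFunctional_comp_max_lt_top (hp₁ : 0 < p₁) (hp : p₁ < p₂) (hr : 1 ≤ r)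
    {K : ℝ≥0∞} (hK : K ≠ ∞) (hφ : ∀ t, 0 < t → φ t ≤ K * ENNReal.ofReal t ^ (-(1 / p₁)))
    {a : ℝ} (ha : 0 < a) :
    lorentzFunctional p₂ r (fun t => φ (max t a)) < ∞ := by
  have hp₂ : 0 < p₂ := hp₁.trans hp
  have hexp : 1 / p₂ - 1 / p₁ < 0 := by
    have := one_div_lt_one_div_of_lt hp₁ hp
    linarith
  have haK : K * ENNReal.ofReal a ^ (-(1 / p₁)) ≠ ∞ :=
    ENNReal.mul_ne_top hK (ENNReal.rpow_ne_top_of_ne_zero (by simp [ha]) (by simp))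
  unfold lorentzFunctional
  split_ifs with h
  · refine (iSup₂_le (a := K * ENNReal.ofReal a ^ (1 / p₂ - 1 / p₁)) fun t ht => ?_).trans_lt
      (ENNReal.mul_lt_top hK.lt_top
        (ENNReal.rpow_ne_top_of_ne_zero (by simp [ha]) (by simp)).lt_top)
    have hm : 0 < max t a := lt_max_of_lt_right ha
    calc ENNReal.ofReal t ^ (1 / p₂) * φ (max t a)
        ≤ ENNReal.ofReal (max t a) ^ (1 / p₂) *
            (K * ENNReal.ofReal (max t a) ^ (-(1 / p₁))) := by
          gcongr
          · exact le_max_left _ _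
          · exact hφ _ hm
      _ = K * ENNReal.ofReal (max t a) ^ (1 / p₂ - 1 / p₁) := by
          rw [mul_left_comm, ENNReal.ofReal_rpow_mul_rpow hm, sub_eq_add_neg]
      _ ≤ _ := by
          refine mul_le_mul' le_rfl ?_
          exact ENNReal.ofReal_rpow_le_of_nonpos ha (le_max_right _ _) hexp.le
  · have hρ := ENNReal.one_le_toReal_of_one_le hr h
    set ρ := r.toReal
    have hρ0 : 0 < ρ := by linarith
    have he₂ : 0 < ρ / p₂ := by positivity
    have hee : ρ / p₂ - ρ / p₁ < 0 := by
      have : ρ / p₂ - ρ / p₁ = ρ * (1 / p₂ - 1 / p₁) := by ring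
      rw [this]
      exact mul_neg_of_pos_of_neg hρ0 hexp
    refine ENNReal.rpow_lt_top_of_nonneg (by positivity) (ne_of_lt ?_)
    rw [setLIntegral_congr_fun measurableSet_Ioi fun t ht =>
      ofReal_rpow_mul_rpow_div ht hρ0.le (φ (max t a)), setLIntegral_Ioi_zero_eq_add ha]
    refine ENNReal.add_lt_top.2 ⟨?_, ?_⟩
    · calc _ ≤ ∫⁻ s in Ioc 0 a, ENNReal.ofReal s ^ (ρ / p₂ - 1) *
            (K * ENNReal.ofReal a ^ (-(1 / p₁))) ^ ρ := by
            refine setLIntegral_mono' measurableSet_Ioc fun s hs => ?_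
            rw [max_eq_right hs.2]
            gcongr
            exact hφ a ha
        _ = ENNReal.ofReal a ^ (ρ / p₂) / ENNReal.ofReal (ρ / p₂) *
            (K * ENNReal.ofReal a ^ (-(1 / p₁))) ^ ρ := by
            rw [lintegral_mul_const _ (by fun_prop),
              setLIntegral_Ioc_ofReal_rpow (by linarith) ha, sub_add_cancel]
        _ < ∞ := by
            refine ENNReal.mul_lt_top (ENNReal.div_lt_top ?_ ?_)
              (ENNReal.rpow_lt_top_of_nonneg hρ0.le haK)
            · exact ENNReal.rpow_ne_top_of_nonneg he₂.le (by simp)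
            · simp only [ne_eq, ENNReal.ofReal_eq_zero, not_le]
              exact he₂
    · calc _ ≤ ∫⁻ s in Ioi a, K ^ ρ * ENNReal.ofReal s ^ (ρ / p₂ - ρ / p₁ - 1) := by
            refine setLIntegral_mono' measurableSet_Ioi fun s hs => ?_
            have hs' : a < s := hs
            rw [max_eq_left hs'.le]
            calc _ ≤ ENNReal.ofReal s ^ (ρ / p₂ - 1) *
                  (K * ENNReal.ofReal s ^ (-(1 / p₁))) ^ ρ := by
                  gcongr
                  exact hφ s (ha.trans hs')
              _ = _ := by
                  rw [ENNReal.mul_rpow_of_nonneg _ _ hρ0.le, ← ENNReal.rpow_mul, mul_left_comm,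
                    ENNReal.ofReal_rpow_mul_rpow (ha.trans hs')]
                  congr 2
                  ring
        _ < ∞ := by
            rw [lintegral_const_mul' _ _ (ENNReal.rpow_ne_top_of_nonneg hρ0.le hK)]
            exact ENNReal.mul_lt_top (ENNReal.rpow_lt_top_of_nonneg hρ0.le hK)
              (setLIntegral_Ioi_ofReal_rpow_lt_top (by linarith) ha)

/-- The embedding of `L^(p,r)` into weak `L^p`: an antitone `φ` is at least `φ t` on `(0, t]`, so
the integral there dominates a multiple of `(t^(1/p) φ t)^ρ`. -/
theorem exists_le_mul_rpow_of_lorentzFunctional_lt_top (hp : 0 < p) (hr : 1 ≤ r)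
    (hφ : AntitoneOn φ (Ioi 0)) (h : lorentzFunctional p r φ < ∞) :
    ∃ K : ℝ≥0∞, K ≠ ∞ ∧ ∀ t, 0 < t → φ t ≤ K * ENNReal.ofReal t ^ (-(1 / p)) := by
  suffices H : ∃ K : ℝ≥0∞, K ≠ ∞ ∧ ∀ t, 0 < t → ENNReal.ofReal t ^ (1 / p) * φ t ≤ K by
    obtain ⟨K, hK, H⟩ := H
    refine ⟨K, hK, fun t ht => ?_⟩
    calc φ t = ENNReal.ofReal t ^ (1 / p) * φ t * ENNReal.ofReal t ^ (-(1 / p)) := by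
          rw [mul_right_comm, ENNReal.ofReal_rpow_mul_rpow ht, add_neg_cancel, ENNReal.rpow_zero,
            one_mul]
      _ ≤ _ := by gcongr; exact H t ht
  unfold lorentzFunctional at h
  split_ifs at h with hr'
  · exact ⟨_, h.ne, fun t ht => le_iSup₂ (f := fun (t : ℝ) (_ : t ∈ Ioi (0 : ℝ)) =>
      ENNReal.ofReal t ^ (1 / p) * φ t) t ht⟩
  · have hρ := ENNReal.one_le_toReal_of_one_le hr hr'
    set ρ := r.toReal
    have hρ0 : 0 < ρ := by linarith
    have he : 0 < ρ / p := by positivity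
    rw [setLIntegral_congr_fun measurableSet_Ioi fun t ht =>
      ofReal_rpow_mul_rpow_div ht hρ0.le (φ t)] at h
    set I := ∫⁻ t in Ioi (0 : ℝ), ENNReal.ofReal t ^ (ρ / p - 1) * φ t ^ ρ
    have hI : I ≠ ∞ := fun hI => by
      rw [hI, ENNReal.top_rpow_of_pos (by positivity)] at h
      exact h.ne rfl
    refine ⟨(I * ENNReal.ofReal (ρ / p)) ^ (1 / ρ), ENNReal.rpow_ne_top_of_nonneg (by positivity)
      (ENNReal.mul_ne_top hI (by simp)), fun t ht => ?_⟩
    rw [one_div ρ, ENNReal.le_rpow_inv_iff hρ0, ENNReal.mul_rpow_of_nonneg _ _ hρ0.le,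
      ← ENNReal.rpow_mul, one_div_mul_eq_div,
      ← ENNReal.div_le_iff (by simpa using he) (by simp)]
    calc _ = ENNReal.ofReal t ^ (ρ / p) / ENNReal.ofReal (ρ / p) * φ t ^ ρ := by
          simp only [ENNReal.div_eq_inv_mul]
          ring
      _ ≤ ∫⁻ s in Ioc 0 t, ENNReal.ofReal s ^ (ρ / p - 1) * φ s ^ ρ :=
          rpow_mul_div_le_setLIntegral hφ he hρ0.le ht
      _ ≤ I := lintegral_mono_set Ioc_subset_Ioi_self

variable {α : Type*} [MeasurableSpace α] {μ : Measure α}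

/-- Averaging the decay `f*(s) ≤ K s^(-1/p)` keeps its order because `p > 1` makes this power
integrable at `0`. -/
theorem exists_averagedRearrangement_le_mul_rpow {f : α → ℝ} (hp : 1 < p) (hr : 1 ≤ r)
    (h : lorentzQuasiNorm f p r μ < ∞) :
    ∃ K : ℝ≥0∞, K ≠ ∞ ∧
      ∀ t, 0 < t → averagedRearrangement f μ t ≤ K * ENNReal.ofReal t ^ (-(1 / p)) := by
  have hp0 : 0 < p := by linarith
  have he : 0 < -(1 / p) + 1 := by
    have := (div_lt_one hp0).2 hp
    linarith
  obtain ⟨K, hK, H⟩ := exists_le_mul_rpow_of_lorentzFunctional_lt_top hp0 hr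
    ((decreasingRearrangement_antitone f μ).antitoneOn _) h
  refine ⟨K / ENNReal.ofReal (-(1 / p) + 1), ENNReal.div_ne_top hK (by simpa using he),
    fun t ht => ?_⟩
  rw [averagedRearrangement, ENNReal.div_le_iff (by simp [ht]) (by simp)]
  calc _ ≤ ∫⁻ s in Ioc 0 t, decreasingRearrangement f μ s := lintegral_mono_set Ioo_subset_Ioc_self
    _ ≤ ∫⁻ s in Ioc 0 t, K * ENNReal.ofReal s ^ (-(1 / p)) :=
        setLIntegral_mono' measurableSet_Ioc fun s hs => H s hs.1
    _ = K * (ENNReal.ofReal t ^ (-(1 / p) + 1) / ENNReal.ofReal (-(1 / p) + 1)) := by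
        rw [lintegral_const_mul' _ _ hK, setLIntegral_Ioc_ofReal_rpow (by linarith) ht]
    _ = _ := by
        rw [← ENNReal.ofReal_rpow_mul_rpow ht, ENNReal.rpow_one]
        simp only [div_eq_mul_inv]
        ring

theorem lorentzQuasiNorm_le_lorentzNorm (f : α → ℝ) :
    lorentzQuasiNorm f p r μ ≤ lorentzNorm f p r μ :=
  lorentzFunctional_mono fun _ ht => decreasingRearrangement_le_averagedRearrangement f μ ht

/-- An integral operator whose kernel satisfies `∫ k(x,·) ≤ A`, `∫ k(·,y) ≤ A * l` and
`k ≤ A / a` maps `L^{(p₁,r)}` into `L^{(p₂,r)}` for `p₁ < p₂`. -/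
theorem memLorentz_and_lorentzNorm_le_of_kernel {β : Type*} [MeasurableSpace β] {ν : Measure β}
    [SFinite μ] [SFinite ν] (hp₁ : 1 < p₁) (hp : p₁ < p₂) (hr : 1 ≤ r) {f : α → ℝ}
    (hf : MemLorentz f p₁ r μ) {u : β → ℝ} (hu : AEStronglyMeasurable u ν)
    {k : β → α → ℝ≥0∞} (hk : Measurable (Function.uncurry k)) {A : ℝ≥0∞} (hAt : A ≠ ∞)
    {l a : ℝ} (hl : 0 < l) (ha : 0 < a)
    (hA : ∀ x, ∫⁻ y, k x y ∂μ ≤ A) (hB : ∀ y, ∫⁻ x, k x y ∂ν ≤ A * ENNReal.ofReal l)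
    (hM : ∀ x y, k x y ≤ A / ENNReal.ofReal a)
    (huk : ∀ x, ‖u x‖ₑ ≤ ∫⁻ y, k x y * ‖f y‖ₑ ∂μ) :
    MemLorentz u p₂ r ν ∧ lorentzNorm u p₂ r ν ≤
      A * (ENNReal.ofReal l ^ (1 / p₂) * (ENNReal.ofReal (p₂ / p₁)
        * ENNReal.ofReal a ^ (1 / p₂ - 1 / p₁) * lorentzNorm f p₁ r μ)) := by
  have hp₁0 : 0 < p₁ := by linarith
  set φ := averagedRearrangement f μ with hφ
  -- Both `A φ(s/l)` and `A φ(a)` bound `u**(s)`; `φ` being antitone, the better one has the larger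
  -- argument.
  have hmax : ∀ s, 0 < s → averagedRearrangement u ν s ≤ A * φ (max (s / l) a) := by
    intro s hs
    rcases le_total (s / l) a with hsa | hsa
    · rw [max_eq_right hsa]
      refine averagedRearrangement_le_of_enorm_le hu (fun x => (huk x).trans ?_) hs
      exact lintegral_kernel_mul_enorm_le hf.1 (hk.comp measurable_prodMk_left) ha (hA x) (hM x)
    · rw [max_eq_left hsa]
      exact averagedRearrangement_le_of_kernel hf.1 hu hk hl hA hB huk hs
  have hle : lorentzNorm u p₂ r ν ≤ A * (ENNReal.ofReal l ^ (1 / p₂) *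
      lorentzFunctional p₂ r fun t => φ (max t a)) :=
    calc _ ≤ lorentzFunctional p₂ r fun s => A * φ (max (s / l) a) := lorentzFunctional_mono hmax
      _ ≤ A * lorentzFunctional p₂ r fun s => φ (max (s / l) a) :=
          lorentzFunctional_const_mul_le hr hAt
      _ ≤ _ := by
          gcongr
          exact lorentzFunctional_comp_div_le (φ := fun t => φ (max t a)) (hp₁0.trans hp) hr hl
  refine ⟨⟨hu, (lorentzQuasiNorm_le_lorentzNorm u).trans_lt (hle.trans_lt ?_)⟩, hle.trans ?_⟩
  · obtain ⟨K, hK, H⟩ := exists_averagedRearrangement_le_mul_rpow hp₁ hr hf.2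
    refine ENNReal.mul_lt_top hAt.lt_top (ENNReal.mul_lt_top ?_
      (lorentzFunctional_comp_max_lt_top hp₁0 hp hr hK H ha))
    exact (ENNReal.rpow_ne_top_of_ne_zero (by simp [hl]) (by simp)).lt_top
  · gcongr
    exact lorentzFunctional_comp_max_le hp₁0 hp hr (averagedRearrangement_antitoneOn hf.1) ha

end LorentzFunctional

/-! ### Gaussian bounds for the kernel and their consequences for the operator. -/

section HeatKernel

theorem lintegral_gaussian_sub {V : Type*} [NormedAddCommGroup V] [InnerProductSpace ℝ V]
    [FiniteDimensional ℝ V] [MeasurableSpace V] [BorelSpace V] {t : ℝ} (ht : 0 < t) (w : V) :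
    ∫⁻ v : V, ENNReal.ofReal (Real.exp (-‖v - w‖ ^ 2 / (4 * t)))
      = ENNReal.ofReal ((4 * Real.pi * t) ^ (Module.finrank ℝ V / 2 : ℝ)) := by
  have h1 := GaussianFourier.integral_rexp_neg_mul_sq_norm (V := V) (b := 1 / (4 * t))
    (by positivity)
  have h2 : ∀ v : V, Real.exp (-(1 / (4 * t)) * ‖v‖ ^ 2) = Real.exp (-‖v‖ ^ 2 / (4 * t)) :=
    fun v => by congr 1; ring
  have h3 : Real.pi / (1 / (4 * t)) = 4 * Real.pi * t := by field_simp
  simp only [h2, h3] at h1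
  have hpos : 0 < (4 * Real.pi * t) ^ (Module.finrank ℝ V / 2 : ℝ) := by positivity
  -- The integral of a non-integrable function is `0` by convention, so the positive value in `h1`
  -- already yields integrability.
  have hi : Integrable fun v : V => Real.exp (-‖v‖ ^ 2 / (4 * t)) := by
    by_contra hn
    rw [integral_undef hn] at h1
    exact hpos.ne h1
  rw [lintegral_sub_right_eq_self
    (fun v : V => ENNReal.ofReal (Real.exp (-‖v‖ ^ 2 / (4 * t)))) w, ← h1,
    ofReal_integral_eq_lintegral_ofReal hi (Filter.Eventually.of_forall fun _ => by positivity)]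

variable {m : ℕ}

theorem reflectedPoint_boundaryPoint (y : EuclideanSpace ℝ (Fin m)) :
    reflectedPoint (boundaryPoint y) = boundaryPoint y := by
  simp [reflectedPoint, boundaryPoint]

/-- The projection `x ↦ x'` of `ℝ^{m+1}` onto the boundary. -/
def boundaryProjection (x : EuclideanSpace ℝ (Fin (m + 1))) : EuclideanSpace ℝ (Fin m) :=
  WithLp.toLp 2 fun i => x i.castSucc

theorem norm_boundaryProjection_sub_sq_le (x : EuclideanSpace ℝ (Fin (m + 1)))
    (y : EuclideanSpace ℝ (Fin m)) :
    ‖boundaryProjection x - y‖ ^ 2 ≤ ‖x - boundaryPoint y‖ ^ 2 := by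
  rw [EuclideanSpace.real_norm_sq_eq, EuclideanSpace.real_norm_sq_eq, Fin.sum_univ_castSucc]
  simp only [boundaryProjection, boundaryPoint, PiLp.sub_apply, Fin.snoc_castSucc]
  exact le_add_of_nonneg_right (sq_nonneg _)

theorem norm_boundaryPoint_sub_boundaryPoint_sq (x y : EuclideanSpace ℝ (Fin m)) :
    ‖boundaryPoint x - boundaryPoint y‖ ^ 2 = ‖x - y‖ ^ 2 := by
  rw [EuclideanSpace.real_norm_sq_eq, EuclideanSpace.real_norm_sq_eq, Fin.sum_univ_castSucc]
  simp [boundaryPoint]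

theorem continuous_boundaryPoint :
    Continuous (boundaryPoint : EuclideanSpace ℝ (Fin m) → EuclideanSpace ℝ (Fin (m + 1))) := by
  refine (PiLp.continuous_toLp 2 _).comp (continuous_pi fun i => ?_)
  refine Fin.lastCases ?_ (fun i => ?_) i
  · simp only [Fin.snoc_last]
    exact continuous_const
  · simp only [Fin.snoc_castSucc]
    fun_prop

theorem halfSpaceHeatKernel_boundaryPoint (x : EuclideanSpace ℝ (Fin (m + 1)))
    (y : EuclideanSpace ℝ (Fin m)) (t : ℝ) :
    halfSpaceHeatKernel x (boundaryPoint y) t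
      = 2 * (4 * Real.pi * t) ^ (-((m : ℝ) + 1) / 2)
        * Real.exp (-‖x - boundaryPoint y‖ ^ 2 / (4 * t)) := by
  rw [halfSpaceHeatKernel, reflectedPoint_boundaryPoint]
  ring

theorem continuous_halfSpaceHeatKernel_boundaryPoint (t : ℝ) :
    Continuous fun z : EuclideanSpace ℝ (Fin (m + 1)) × EuclideanSpace ℝ (Fin m) =>
      halfSpaceHeatKernel z.1 (boundaryPoint z.2) t := by
  simp only [halfSpaceHeatKernel_boundaryPoint]
  have := continuous_boundaryPoint (m := m)
  fun_prop

variable {t : ℝ}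

theorem halfSpaceHeatKernel_boundaryPoint_nonneg (ht : 0 < t)
    (x : EuclideanSpace ℝ (Fin (m + 1))) (y : EuclideanSpace ℝ (Fin m)) :
    0 ≤ halfSpaceHeatKernel x (boundaryPoint y) t := by
  rw [halfSpaceHeatKernel_boundaryPoint]
  positivity

theorem halfSpaceHeatKernel_boundaryPoint_le (ht : 0 < t) (x : EuclideanSpace ℝ (Fin (m + 1)))
    (y : EuclideanSpace ℝ (Fin m)) :
    ENNReal.ofReal (halfSpaceHeatKernel x (boundaryPoint y) t)
      ≤ ENNReal.ofReal (2 * (4 * Real.pi * t) ^ (-1 / 2 : ℝ))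
        / ENNReal.ofReal ((4 * Real.pi * t) ^ ((m : ℝ) / 2)) := by
  rw [← ENNReal.ofReal_div_of_pos (by positivity), mul_div_assoc, ← Real.rpow_sub (by positivity),
    show (-1 / 2 - (m : ℝ) / 2) = -((m : ℝ) + 1) / 2 by ring, halfSpaceHeatKernel_boundaryPoint]
  refine ENNReal.ofReal_le_ofReal (mul_le_of_le_one_right (by positivity) ?_)
  rw [Real.exp_le_one_iff]
  exact div_nonpos_of_nonpos_of_nonneg (neg_nonpos.2 (sq_nonneg _)) (by positivity)

/-- Dropping the normal coordinate of `x` only increases the Gaussian, leaving an `m`-dimensional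
integral in `y` and a bound uniform in `x`. -/
theorem lintegral_halfSpaceHeatKernel_right_le (ht : 0 < t)
    (x : EuclideanSpace ℝ (Fin (m + 1))) :
    ∫⁻ y, ENNReal.ofReal (halfSpaceHeatKernel x (boundaryPoint y) t)
      ≤ ENNReal.ofReal (2 * (4 * Real.pi * t) ^ (-1 / 2 : ℝ)) := by
  calc _ ≤ ∫⁻ y, ENNReal.ofReal (2 * (4 * Real.pi * t) ^ (-((m : ℝ) + 1) / 2)) *
        ENNReal.ofReal (Real.exp (-‖y - boundaryProjection x‖ ^ 2 / (4 * t))) := by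
        refine lintegral_mono fun y => ?_
        rw [← ENNReal.ofReal_mul (by positivity), halfSpaceHeatKernel_boundaryPoint, norm_sub_rev y]
        refine ENNReal.ofReal_le_ofReal (mul_le_mul_of_nonneg_left (Real.exp_le_exp.2 ?_)
          (by positivity))
        exact div_le_div_of_nonneg_right (neg_le_neg (norm_boundaryProjection_sub_sq_le x y))
          (by positivity)
    _ = _ := by
        rw [lintegral_const_mul' _ _ ENNReal.ofReal_ne_top, lintegral_gaussian_sub ht,
          ← ENNReal.ofReal_mul (by positivity), mul_assoc 2, ← Real.rpow_add (by positivity),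
          finrank_euclideanSpace_fin]
        congr 3
        ring

theorem lintegral_halfSpaceHeatKernel_boundary (ht : 0 < t) (y : EuclideanSpace ℝ (Fin m)) :
    ∫⁻ x, ENNReal.ofReal (halfSpaceHeatKernel (boundaryPoint x) (boundaryPoint y) t)
      = ENNReal.ofReal (2 * (4 * Real.pi * t) ^ (-1 / 2 : ℝ)) := by
  calc _ = ∫⁻ x, ENNReal.ofReal (2 * (4 * Real.pi * t) ^ (-((m : ℝ) + 1) / 2)) *
        ENNReal.ofReal (Real.exp (-‖x - y‖ ^ 2 / (4 * t))) := by
        refine lintegral_congr fun x => ?_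
        rw [← ENNReal.ofReal_mul (by positivity), halfSpaceHeatKernel_boundaryPoint,
          norm_boundaryPoint_sub_boundaryPoint_sq]
    _ = _ := by
        rw [lintegral_const_mul' _ _ ENNReal.ofReal_ne_top, lintegral_gaussian_sub ht,
          ← ENNReal.ofReal_mul (by positivity), mul_assoc 2, ← Real.rpow_add (by positivity),
          finrank_euclideanSpace_fin]
        congr 3
        ring

/-- Integrating over one dimension more than on the boundary produces the extra factor `l =
(4πt)^(1/2)`. The integral over all of space is an upper bound for the one over the half-space. -/
theorem lintegral_halfSpaceHeatKernel_left (ht : 0 < t) (y : EuclideanSpace ℝ (Fin m)) :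
    ∫⁻ x, ENNReal.ofReal (halfSpaceHeatKernel x (boundaryPoint y) t)
      = ENNReal.ofReal (2 * (4 * Real.pi * t) ^ (-1 / 2 : ℝ))
        * ENNReal.ofReal ((4 * Real.pi * t) ^ (1 / 2 : ℝ)) := by
  calc _ = ∫⁻ x, ENNReal.ofReal (2 * (4 * Real.pi * t) ^ (-((m : ℝ) + 1) / 2)) *
        ENNReal.ofReal (Real.exp (-‖x - boundaryPoint y‖ ^ 2 / (4 * t))) := by
        refine lintegral_congr fun x => ?_
        rw [← ENNReal.ofReal_mul (by positivity), halfSpaceHeatKernel_boundaryPoint]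
    _ = _ := by
        rw [lintegral_const_mul' _ _ ENNReal.ofReal_ne_top, lintegral_gaussian_sub ht,
          ← ENNReal.ofReal_mul (by positivity), ← ENNReal.ofReal_mul (by positivity),
          mul_assoc 2, mul_assoc 2, ← Real.rpow_add (by positivity), ← Real.rpow_add (by positivity),
          finrank_euclideanSpace_fin]
        congr 3
        push_cast
        ring

variable {ψ : EuclideanSpace ℝ (Fin m) → ℝ}

theorem enorm_boundaryOperator_le (ht : 0 < t) (x : EuclideanSpace ℝ (Fin (m + 1))) :
    ‖boundaryOperator ψ x t‖ₑ
      ≤ ∫⁻ y, ENNReal.ofReal (halfSpaceHeatKernel x (boundaryPoint y) t) * ‖ψ y‖ₑ := by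
  refine (enorm_integral_le_lintegral_enorm _).trans (le_of_eq (lintegral_congr fun y => ?_))
  rw [enorm_mul, Real.enorm_of_nonneg (halfSpaceHeatKernel_boundaryPoint_nonneg ht x y)]

theorem aestronglyMeasurable_boundaryOperator {X : Type*} [MeasurableSpace X] {ν : Measure X}
    [SFinite ν] (hψ : AEStronglyMeasurable ψ volume) (t : ℝ)
    {e : X → EuclideanSpace ℝ (Fin (m + 1))} (he : Measurable e) :
    AEStronglyMeasurable (fun x => boundaryOperator ψ (e x) t) ν := by
  refine AEStronglyMeasurable.integral_prod_right'
    (f := fun z : X × EuclideanSpace ℝ (Fin m) =>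
      halfSpaceHeatKernel (e z.1) (boundaryPoint z.2) t * ψ z.2) ?_
  refine AEStronglyMeasurable.mul ?_ hψ.comp_snd
  exact ((continuous_halfSpaceHeatKernel_boundaryPoint t).measurable.comp
    ((he.comp measurable_fst).prodMk measurable_snd)).aestronglyMeasurable

theorem integrable_halfSpaceHeatKernel_mul {d : ℝ} {r : ℝ≥0∞} (hd : 1 < d) (hr : 1 ≤ r)
    (hψ : MemLorentz ψ d r volume) (ht : 0 < t) (x : EuclideanSpace ℝ (Fin (m + 1))) :
    Integrable (fun y => halfSpaceHeatKernel x (boundaryPoint y) t * ψ y) volume := by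
  have hk : Continuous fun y : EuclideanSpace ℝ (Fin m) =>
      halfSpaceHeatKernel x (boundaryPoint y) t := by
    have hbp := continuous_boundaryPoint (m := m)
    simp only [halfSpaceHeatKernel_boundaryPoint]
    fun_prop
  have ha : 0 < (4 * Real.pi * t) ^ ((m : ℝ) / 2) := by positivity
  refine ⟨hk.aestronglyMeasurable.mul hψ.1, ?_⟩
  obtain ⟨K, hK, H⟩ := exists_averagedRearrangement_le_mul_rpow hd hr hψ.2
  rw [hasFiniteIntegral_iff_enorm]
  calc _ = ∫⁻ y, ENNReal.ofReal (halfSpaceHeatKernel x (boundaryPoint y) t) * ‖ψ y‖ₑ := by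
        refine lintegral_congr fun y => ?_
        rw [enorm_mul, Real.enorm_of_nonneg (halfSpaceHeatKernel_boundaryPoint_nonneg ht x y)]
    _ ≤ ENNReal.ofReal (2 * (4 * Real.pi * t) ^ (-1 / 2 : ℝ))
          * averagedRearrangement ψ volume ((4 * Real.pi * t) ^ ((m : ℝ) / 2)) :=
        lintegral_kernel_mul_enorm_le hψ.1 hk.measurable.ennreal_ofReal ha
        (lintegral_halfSpaceHeatKernel_right_le ht x) (halfSpaceHeatKernel_boundaryPoint_le ht x)
    _ < ∞ := by
        refine ENNReal.mul_lt_top ENNReal.ofReal_lt_top ((H _ ha).trans_lt ?_)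
        exact ENNReal.mul_lt_top hK.lt_top
          (ENNReal.rpow_ne_top_of_ne_zero (by simpa using ha) (by simp)).lt_top

/-- Treats both target spaces at once: `e` embeds the target, and `q` is its dimension minus `m`,
that is, `0` for the boundary and `1` for the half-space. -/
theorem memLorentz_and_lorentzNorm_boundaryOperator_le {X : Type*} [MeasurableSpace X]
    {ν : Measure X} [SFinite ν] {d₁ d₂ : ℝ} {r : ℝ≥0∞} (hd₁ : 1 < d₁) (hd : d₁ < d₂)
    (hr : 1 ≤ r) (hψ : MemLorentz ψ d₁ r volume) (ht : 0 < t)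
    {e : X → EuclideanSpace ℝ (Fin (m + 1))} (he : Measurable e) {q : ℝ}
    (hB : ∀ y, ∫⁻ x, ENNReal.ofReal (halfSpaceHeatKernel (e x) (boundaryPoint y) t) ∂ν
      ≤ ENNReal.ofReal (2 * (4 * Real.pi * t) ^ (-1 / 2 : ℝ))
        * ENNReal.ofReal ((4 * Real.pi * t) ^ (q / 2)))
    {E : ℝ} (hE : E = -((m : ℝ) / (2 * d₁) - (m + q) / (2 * d₂) + 1 / 2)) {C : ℝ}
    (hC : 2 * (d₂ / d₁) * (4 * Real.pi) ^ E ≤ C) :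
    MemLorentz (fun x => boundaryOperator ψ (e x) t) d₂ r ν ∧
      lorentzNorm (fun x => boundaryOperator ψ (e x) t) d₂ r ν
        ≤ ENNReal.ofReal (C * t ^ E) * lorentzNorm ψ d₁ r volume := by
  have hT : 0 < 4 * Real.pi * t := by positivity
  have hd₁0 : 0 < d₁ := by linarith
  have hd₂0 : 0 < d₂ := by linarith
  obtain ⟨h1, h2⟩ := memLorentz_and_lorentzNorm_le_of_kernel hd₁ hd hr hψ
    (aestronglyMeasurable_boundaryOperator hψ.1 t he)
    (k := fun x y => ENNReal.ofReal (halfSpaceHeatKernel (e x) (boundaryPoint y) t))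
    (((continuous_halfSpaceHeatKernel_boundaryPoint t).measurable.comp
      ((he.comp measurable_fst).prodMk measurable_snd)).ennreal_ofReal)
    ENNReal.ofReal_ne_top (Real.rpow_pos_of_pos hT (q / 2)) (Real.rpow_pos_of_pos hT ((m : ℝ) / 2))
    (fun x => lintegral_halfSpaceHeatKernel_right_le ht (e x)) hB
    (fun x => halfSpaceHeatKernel_boundaryPoint_le ht (e x))
    (fun x => enorm_boundaryOperator_le ht (e x))
  refine ⟨h1, h2.trans ?_⟩
  rw [← mul_assoc, ← mul_assoc, ENNReal.ofReal_rpow_of_pos (by positivity),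
    ENNReal.ofReal_rpow_of_pos (by positivity), ← ENNReal.ofReal_mul (by positivity),
    ← ENNReal.ofReal_mul (by positivity), ← ENNReal.ofReal_mul (by positivity)]
  refine mul_le_mul' (ENNReal.ofReal_le_ofReal ?_) le_rfl
  -- The exponent `E` collects `-1/2` from `A`, `q / (2 d₂)` from `l^(1/d₂)`, and `(m/2)(1/d₂ -
  -- 1/d₁)` from the power of `a`.
  calc _ = 2 * (d₂ / d₁) * (4 * Real.pi * t) ^ E := by
        rw [← Real.rpow_mul hT.le, ← Real.rpow_mul hT.le,
          show E = -1 / 2 + (q / 2 * (1 / d₂) + (m : ℝ) / 2 * (1 / d₂ - 1 / d₁)) by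
            rw [hE]; field_simp; ring,
          Real.rpow_add hT, Real.rpow_add hT]
        ring
    _ = 2 * (d₂ / d₁) * (4 * Real.pi) ^ E * t ^ E := by
        rw [Real.mul_rpow (by positivity) ht.le]
        ring
    _ ≤ _ := by gcongr

end HeatKernel

theorem mainTheorem6 (m : ℕ) (hm : 3 ≤ m + 1) (d₁ d₂ : ℝ) (hd₁ : 1 < d₁) (hd : d₁ < d₂)
    (r : ℝ≥0∞) (hr : 1 ≤ r) :
    ∃ C : ℝ, 0 < C ∧
      ∀ ψ : EuclideanSpace ℝ (Fin m) → ℝ, MemLorentz ψ d₁ r volume →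
      ∀ t : ℝ, 0 < t →
        (∀ x : EuclideanSpace ℝ (Fin (m + 1)),
          Integrable (fun y' => halfSpaceHeatKernel x (boundaryPoint y') t * ψ y') volume) ∧
        (MemLorentz (fun x' => boundaryOperator ψ (boundaryPoint x') t) d₂ r volume ∧
          lorentzNorm (fun x' => boundaryOperator ψ (boundaryPoint x') t) d₂ r volume ≤
            ENNReal.ofReal
                (C * t ^ (-((m : ℝ) / (2 * d₁) - (m : ℝ) / (2 * d₂) + 1 / 2))) *
              lorentzNorm ψ d₁ r volume) ∧
        (MemLorentz (fun x => boundaryOperator ψ x t) d₂ r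
            (volume.restrict (upperHalfSpace m)) ∧
          lorentzNorm (fun x => boundaryOperator ψ x t) d₂ r
              (volume.restrict (upperHalfSpace m)) ≤
            ENNReal.ofReal
                (C * t ^ (-((m : ℝ) / (2 * d₁) - ((m : ℝ) + 1) / (2 * d₂) + 1 / 2))) *
              lorentzNorm ψ d₁ r volume) := by
  have hd₁0 : 0 < d₁ := by linarith
  have hd₂0 : 0 < d₂ := by linarith
  have hpos : ∀ E : ℝ, 0 < 2 * (d₂ / d₁) * (4 * Real.pi) ^ E := fun E => by positivity
  -- The two estimates have different powers of `4π`; the sum of their constants serves both.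
  refine ⟨_, add_pos (hpos (-((m : ℝ) / (2 * d₁) - (m : ℝ) / (2 * d₂) + 1 / 2)))
    (hpos (-((m : ℝ) / (2 * d₁) - ((m : ℝ) + 1) / (2 * d₂) + 1 / 2))), fun ψ hψ t ht =>
    ⟨fun x => integrable_halfSpaceHeatKernel_mul hd₁ hr hψ ht x, ?_, ?_⟩⟩
  · refine memLorentz_and_lorentzNorm_boundaryOperator_le hd₁ hd hr hψ ht
      continuous_boundaryPoint.measurable (q := 0) (fun y => ?_) (by rw [add_zero])
      (le_add_of_nonneg_right (hpos _).le)
    rw [lintegral_halfSpaceHeatKernel_boundary ht]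
    simp
  · refine memLorentz_and_lorentzNorm_boundaryOperator_le hd₁ hd hr hψ ht
      measurable_id (q := 1) (fun y => ?_) rfl (le_add_of_nonneg_left (hpos _).le)
    exact (setLIntegral_le_lintegral _ _).trans (lintegral_halfSpaceHeatKernel_left ht y).le
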